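/- Let $I=[0,1]$. A \emph{Pisot number} is a real algebraic integer $\lambda>1$ all of whose Galois conjugates other than $\lambda$ itself lie in the open unit disk of $\mathbb{C}$. A \emph{critical point} (turning point) of a continuous map $f:I\to I$ is a point of $(0,1)$ at which $f$ has a local maximum or a local minimum, and $f$ is \emph{postcritically finite} if the union of the forward orbits of its critical points is finite. A \emph{$\lambda$-uniform expander} is a continuous piecewise linear map $f:I\to I$ with $|f'|=\lambda>1$ wherever $f'$ exists. (1) For every integer $d>1$ and every Pisot number $\lambda\le d$ there is a continuous postcritically finite map $f:I\to I$ with exactly $d-1$ critical points and topological entropy $\log\lambda$. (2) If $\lambda$ is a Pisot number, then every $\lambda$-uniform expander $f:I\to I$ whose critical points all lie in $\mathbb{Q}(\lambda)$ and which satisfies $f(0)\in\mathbb{Q}(\lambda)$ (for instance, because $f$ maps endpoints of $I$ to endpoints of $I$) is postcritically finite. -/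

import Mathlib

open scoped IntermediateField

/-- A Pisot number: a real algebraic integer greater than `1`, all of whose Galois conjugates in `ℂ`
other than itself lie in the open unit disk. -/
def IsPisot (lam : ℝ) : Prop :=
  1 < lam ∧ IsIntegral ℤ lam ∧
    ∀ z : ℂ, IsConjRoot ℚ (lam : ℂ) z → z ≠ (lam : ℂ) → ‖z‖ < 1

/-- `f` restricts to a continuous map of the unit interval `[0, 1]` to itself.
The values of `f` outside `[0, 1]` play no role. -/
structure IsIntervalMap (f : ℝ → ℝ) : Prop where
  continuousOn : ContinuousOn f (Set.Icc 0 1)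
  mapsTo : Set.MapsTo f (Set.Icc 0 1) (Set.Icc 0 1)

/-- The (topological) critical points, or turning points, of a map of `[0, 1]`: the interior points
that are local maxima or local minima. -/
def turningPoints (f : ℝ → ℝ) : Set ℝ :=
  {x | x ∈ Set.Ioo (0 : ℝ) 1 ∧ IsLocalExtr f x}

/-- The union of the forward orbits of the critical points is finite. -/
def IsPostcriticallyFinite (f : ℝ → ℝ) : Prop :=
  (⋃ x ∈ turningPoints f, Set.range fun n : ℕ => f^[n] x).Finite

/-- `f` is piecewise linear on `[0, 1]`: there is a finite set of break points such that `f` is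
affine on every closed subinterval whose interior contains no break point. -/
def IsPiecewiseLinear (f : ℝ → ℝ) : Prop :=
  ∃ P : Set ℝ, P.Finite ∧ ∀ a ∈ Set.Icc (0 : ℝ) 1, ∀ b ∈ Set.Icc (0 : ℝ) 1,
    Disjoint (Set.Ioo a b) P → ∃ m c : ℝ, ∀ x ∈ Set.Icc a b, f x = m * x + c

/-- A uniform `lam`-expander of `[0, 1]`: a continuous piecewise linear self-map with
`|f'| = lam > 1` wherever `f'` exists. -/
structure IsUniformExpander (lam : ℝ) (f : ℝ → ℝ) : Prop where
  one_lt : 1 < lam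
  isIntervalMap : IsIntervalMap f
  isPiecewiseLinear : IsPiecewiseLinear f
  abs_deriv : ∀ x ∈ Set.Icc (0 : ℝ) 1, ∀ m : ℝ,
    HasDerivWithinAt f m (Set.Icc 0 1) x → |m| = lam

open Set Filter Topology MeasureTheory Dynamics

/-! Finiteness is arithmetic. Along an orbit each step is `u ↦ ± lam * u + b` with `b` in a finite
subset of `ℚ⟮lam⟯`. Denominators stay bounded because `lam` is integral; the inclusion into `ℝ` is
bounded because the orbit stays in `[0, 1]`; every other embedding makes the steps contractions, by
the Pisot property. Only finitely many field elements satisfy these bounds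
(`IsPisot.finite_range_of_signedAffineStep`). The intercepts lie in the field because, moving right
from `0`, they change only at turning points (`IsUniformExpander.exists_intercepts`).

For existence, take a triangle wave with slopes `± lam`, height `lam / d` and turning points `k /
d`. Its entropy is at most `log lam` by the Lipschitz bound. For the lower bound, iterates fold at
most two-to-one locally, so Bowen balls have small Lebesgue measure and many are needed to cover
`[0, 1]`. -/

/-! ### Finiteness of orbits in a Pisot number field -/

/-- `v` is obtained from `u` by a map `x ↦ ± a * x + b` with `b ∈ B`. -/
def IsSignedAffineStep {K : Type*} [Ring K] (a : K) (B : Set K) (u v : K) : Prop :=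
  ∃ m b : K, (m = a ∨ m = -a) ∧ b ∈ B ∧ v = m * u + b

theorem exists_norm_map_le_of_signedAffineStep {K : Type*} [Field K] {a : K} {B : Set K}
    (hB : B.Finite) {u : ℕ → K} (hu : ∀ n, IsSignedAffineStep a B (u n) (u (n + 1)))
    (φ : K →+* ℂ) (hφ : ‖φ a‖ < 1) : ∃ C : ℝ, ∀ n, ‖φ (u n)‖ ≤ C := by
  obtain ⟨M, hM⟩ := (hB.image fun b => ‖φ b‖).bddAbove
  have h1 : 0 < 1 - ‖φ a‖ := by linarith
  -- `M / (1 - ‖φ a‖)` is the fixed point of `t ↦ ‖φ a‖ * t + M`, so any larger bound propagates.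
  refine ⟨max ‖φ (u 0)‖ (M / (1 - ‖φ a‖)), fun n => ?_⟩
  induction n with
  | zero => exact le_max_left _ _
  | succ n ih =>
    obtain ⟨m, b, hm, hb, h⟩ := hu n
    set C := max ‖φ (u 0)‖ (M / (1 - ‖φ a‖))
    have hma : ‖φ m‖ = ‖φ a‖ := by rcases hm with rfl | rfl <;> simp
    have hbM : ‖φ b‖ ≤ M := hM ⟨b, hb, rfl⟩
    have hMC : M ≤ C * (1 - ‖φ a‖) := (div_le_iff₀ h1).1 (le_max_right _ _)
    have hle : ‖φ a‖ * ‖φ (u n)‖ ≤ ‖φ a‖ * C := by gcongr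
    calc ‖φ (u (n + 1))‖ ≤ ‖φ a‖ * ‖φ (u n)‖ + ‖φ b‖ := by
          rw [h, map_add, map_mul, ← hma, ← norm_mul]; exact norm_add_le _ _
      _ ≤ C := by linarith

theorem finite_range_of_signedAffineStep {K : Type*} [Field K] [NumberField K] {a : K}
    (ha : IsIntegral ℤ a) {B : Set K} (hB : B.Finite) {u : ℕ → K}
    (hu : ∀ n, IsSignedAffineStep a B (u n) (u (n + 1)))
    (hbdd : ∀ φ : K →+* ℂ, ∃ C : ℝ, ∀ n, ‖φ (u n)‖ ≤ C) : (range u).Finite := by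
  classical
  -- `y` is a common denominator for `u 0` and all of `B`; it then serves the whole orbit.
  obtain ⟨y, hy, hint⟩ := exists_integral_multiples ℤ ℚ (insert (u 0) hB.toFinset)
  have hyu : ∀ n, IsIntegral ℤ (y • u n) := by
    intro n
    induction n with
    | zero => exact hint _ (by simp)
    | succ n ih =>
      obtain ⟨m, b, hm, hb, h⟩ := hu n
      have hmi : IsIntegral ℤ m := by
        rcases hm with rfl | rfl
        exacts [ha, ha.neg]
      have : y • u (n + 1) = m * (y • u n) + y • b := by
        rw [h, smul_add, mul_smul_comm]
      rw [this]
      exact (hmi.mul ih).add (hint _ (by simp [hb]))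
  choose C hC using hbdd
  obtain ⟨D, hD⟩ := (finite_range C).bddAbove
  have hfin := NumberField.Embeddings.finite_of_norm_le K ℂ (‖(y : ℂ)‖ * D)
  have hsub : (fun x : K => y • x) '' range u ⊆
      {x : K | IsIntegral ℤ x ∧ ∀ φ : K →+* ℂ, ‖φ x‖ ≤ ‖(y : ℂ)‖ * D} := by
    rintro _ ⟨_, ⟨n, rfl⟩, rfl⟩
    refine ⟨hyu n, fun φ => ?_⟩
    have := (hC φ n).trans (hD ⟨φ, rfl⟩)
    simp only [zsmul_eq_mul, map_mul, map_intCast, norm_mul]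
    gcongr
  refine (hfin.subset hsub).of_finite_image fun x _ z _ h => ?_
  exact smul_right_injective K hy h

/-- An embedding of `ℚ⟮lam⟯` is determined by the image of `lam`, so any embedding but the inclusion
sends `lam` to a different conjugate. -/
theorem IsPisot.norm_map_lt_one {lam : ℝ} (h : IsPisot lam) (φ : ℚ⟮lam⟯ →+* ℂ)
    (hφ : φ ≠ Complex.ofRealHom.comp (algebraMap ℚ⟮lam⟯ ℝ)) :
    ‖φ (IntermediateField.AdjoinSimple.gen ℚ lam)‖ < 1 := by
  refine h.2.2 _ ?_ fun heq => hφ ?_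
  · have h1 : minpoly ℚ (φ (IntermediateField.AdjoinSimple.gen ℚ lam)) =
        minpoly ℚ (IntermediateField.AdjoinSimple.gen ℚ lam) :=
      minpoly.algHom_eq φ.toRatAlgHom φ.injective _
    have h2 : minpoly ℚ (lam : ℂ) = minpoly ℚ lam :=
      minpoly.algHom_eq Complex.ofRealHom.toRatAlgHom Complex.ofRealHom.injective lam
    have h3 : minpoly ℚ lam = minpoly ℚ (IntermediateField.AdjoinSimple.gen ℚ lam) :=
      minpoly.algHom_eq (algebraMap ℚ⟮lam⟯ ℝ).toRatAlgHom (algebraMap ℚ⟮lam⟯ ℝ).injective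
        (IntermediateField.AdjoinSimple.gen ℚ lam)
    rw [IsConjRoot, h1, h2, h3]
  · have : φ.toRatAlgHom = (Complex.ofRealHom.comp (algebraMap ℚ⟮lam⟯ ℝ)).toRatAlgHom := by
      refine IntermediateField.algHom_ext_of_eq_adjoin ℚ rfl fun x hx => ?_
      obtain rfl : x = lam := hx
      exact heq
    ext x
    exact DFunLike.congr_fun this x

/-- A bounded orbit in `ℚ⟮lam⟯`, `lam` a Pisot number, of affine maps of slopes `± lam` with
finitely many intercepts is finite. -/
theorem IsPisot.finite_range_of_signedAffineStep {lam : ℝ} (h : IsPisot lam) {B : Set ℝ}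
    (hB : B.Finite) (hBK : B ⊆ ℚ⟮lam⟯) {u : ℕ → ℝ} (hu0 : u 0 ∈ ℚ⟮lam⟯)
    (hu : ∀ n, IsSignedAffineStep lam B (u n) (u (n + 1))) {C : ℝ} (hC : ∀ n, |u n| ≤ C) :
    (range u).Finite := by
  have hint : IsIntegral ℤ (IntermediateField.AdjoinSimple.gen ℚ lam) :=
    (isIntegral_algHom_iff ((algebraMap ℚ⟮lam⟯ ℝ).toIntAlgHom)
      (algebraMap ℚ⟮lam⟯ ℝ).injective).1 h.2.1
  have : FiniteDimensional ℚ ℚ⟮lam⟯ :=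
    IntermediateField.adjoin.finiteDimensional h.2.1.tower_top
  have : NumberField ℚ⟮lam⟯ := ⟨⟩
  have hmem : ∀ n, u n ∈ ℚ⟮lam⟯ := by
    intro n
    induction n with
    | zero => exact hu0
    | succ n ih =>
      obtain ⟨m, b, hm, hb, h'⟩ := hu n
      have hl := IntermediateField.mem_adjoin_simple_self ℚ lam
      have hmK : m ∈ ℚ⟮lam⟯ := by
        rcases hm with rfl | rfl
        exacts [hl, neg_mem hl]
      exact h' ▸ add_mem (mul_mem hmK ih) (hBK hb)
  let v : ℕ → ℚ⟮lam⟯ := fun n => ⟨u n, hmem n⟩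
  have hv : ∀ n, IsSignedAffineStep (IntermediateField.AdjoinSimple.gen ℚ lam)
      (Subtype.val ⁻¹' B) (v n) (v (n + 1)) := by
    intro n
    obtain ⟨m, b, hm, hb, h'⟩ := hu n
    rcases hm with rfl | rfl
    · exact ⟨_, ⟨b, hBK hb⟩, Or.inl rfl, hb, Subtype.ext h'⟩
    · exact ⟨_, ⟨b, hBK hb⟩, Or.inr rfl, hb, Subtype.ext h'⟩
  have hB' : (Subtype.val ⁻¹' B : Set ℚ⟮lam⟯).Finite :=
    hB.preimage Subtype.val_injective.injOn
  have hfin : (range v).Finite := by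
    refine _root_.finite_range_of_signedAffineStep hint hB' hv fun φ => ?_
    by_cases hφ : φ = Complex.ofRealHom.comp (algebraMap ℚ⟮lam⟯ ℝ)
    · refine ⟨C, fun n => ?_⟩
      have : φ (v n) = (u n : ℂ) := by rw [hφ]; rfl
      rw [this, Complex.norm_real]
      exact hC n
    · exact exists_norm_map_le_of_signedAffineStep hB' hv φ (h.norm_map_lt_one φ hφ)
  refine (hfin.image Subtype.val).subset ?_
  rintro _ ⟨n, rfl⟩
  exact ⟨v n, ⟨n, rfl⟩, rfl⟩

/-! ### Affine pieces and intercepts of uniform expanders -/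

/-- `f` is given by `x ↦ m * x + c` on the nondegenerate interval `[a, b]`. -/
structure IsAffinePiece (f : ℝ → ℝ) (a b m c : ℝ) : Prop where
  lt : a < b
  eq : ∀ x ∈ Icc a b, f x = m * x + c

theorem IsAffinePiece.mono {f : ℝ → ℝ} {a b m c a' b' : ℝ} (h : IsAffinePiece f a b m c)
    (ha : a ≤ a') (hab : a' < b') (hb : b' ≤ b) : IsAffinePiece f a' b' m c :=
  ⟨hab, fun x hx => h.eq x ⟨ha.trans hx.1, hx.2.trans hb⟩⟩

theorem IsAffinePiece.unique {f : ℝ → ℝ} {a b m c m' c' : ℝ} (h : IsAffinePiece f a b m c)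
    (h' : IsAffinePiece f a b m' c') : m = m' ∧ c = c' := by
  have hab := h.lt
  have h1 := (h.eq a ⟨le_rfl, hab.le⟩).symm.trans (h'.eq a ⟨le_rfl, hab.le⟩)
  have h2 := (h.eq b ⟨hab.le, le_rfl⟩).symm.trans (h'.eq b ⟨hab.le, le_rfl⟩)
  have h3 : (m - m') * (b - a) = 0 := by linarith
  have h4 : m = m' := by
    rcases mul_eq_zero.1 h3 with h | h <;> linarith
  subst h4
  exact ⟨rfl, by linarith⟩

theorem IsAffinePiece.hasDerivAt {f : ℝ → ℝ} {a b m c x : ℝ} (h : IsAffinePiece f a b m c)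
    (hx : x ∈ Ioo a b) : HasDerivAt f m x := by
  have : HasDerivAt (fun x => m * x + c) m x := by
    simpa using ((hasDerivAt_id x).const_mul m).add_const c
  refine this.congr_of_eventuallyEq ?_
  filter_upwards [Ioo_mem_nhds hx.1 hx.2] with y hy
  exact h.eq y ⟨hy.1.le, hy.2.le⟩

theorem IsAffinePiece.abs_slope {lam : ℝ} {f : ℝ → ℝ} (hf : IsUniformExpander lam f)
    {a b m c : ℝ} (h : IsAffinePiece f a b m c) (ha : 0 ≤ a) (hb : b ≤ 1) : |m| = lam := by
  have hab := h.lt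
  refine hf.abs_deriv ((a + b) / 2) ⟨by linarith, by linarith⟩ m ?_
  exact (h.hasDerivAt ⟨by linarith, by linarith⟩).hasDerivWithinAt

theorem isLocalExtr_of_opposite_slopes {f : ℝ → ℝ} {a p b m c c' : ℝ}
    (h : IsAffinePiece f a p m c) (h' : IsAffinePiece f p b (-m) c') : IsLocalExtr f p := by
  have h1 := h.eq p ⟨h.lt.le, le_rfl⟩
  have h2 := h'.eq p ⟨le_rfl, h'.lt.le⟩
  rcases le_total 0 m with hm | hm
  · right
    filter_upwards [Ioo_mem_nhds h.lt h'.lt] with x hx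
    rcases le_total x p with hxp | hxp
    · rw [h.eq x ⟨hx.1.le, hxp⟩, h1]; nlinarith
    · rw [h'.eq x ⟨hxp, hx.2.le⟩, h2]; nlinarith
  · left
    filter_upwards [Ioo_mem_nhds h.lt h'.lt] with x hx
    rcases le_total x p with hxp | hxp
    · rw [h.eq x ⟨hx.1.le, hxp⟩, h1]; nlinarith
    · rw [h'.eq x ⟨hxp, hx.2.le⟩, h2]; nlinarith

theorem Set.Finite.exists_pos_le_abs_sub {P : Set ℝ} (hP : P.Finite) (p : ℝ) :
    ∃ δ > 0, ∀ x ∈ P, x ≠ p → δ ≤ |x - p| := by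
  have hc : (P \ {p})ᶜ ∈ 𝓝 p :=
    (hP.subset sdiff_subset).isClosed.isOpen_compl.mem_nhds (by simp)
  obtain ⟨δ, hδ, hs⟩ := Metric.mem_nhds_iff.1 hc
  refine ⟨δ, hδ, fun x hx hxp => ?_⟩
  by_contra! hlt
  exact hs (Metric.mem_ball.2 (by rwa [Real.dist_eq])) ⟨hx, hxp⟩

/-- Every point of `(0, 1]` is the right end of an affine piece. -/
theorem IsPiecewiseLinear.exists_piece_left {f : ℝ → ℝ} (hf : IsPiecewiseLinear f) {p : ℝ}
    (hp : p ∈ Ioc (0 : ℝ) 1) : ∃ a m c, 0 ≤ a ∧ IsAffinePiece f a p m c := by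
  obtain ⟨P, hP, h⟩ := hf
  obtain ⟨δ, hδ, hd⟩ := hP.exists_pos_le_abs_sub p
  have hlt : max 0 (p - δ) < p := max_lt hp.1 (by linarith)
  obtain ⟨m, c, hmc⟩ := h (max 0 (p - δ)) ⟨le_max_left _ _, hlt.le.trans hp.2⟩ p
    ⟨hp.1.le, hp.2⟩ (disjoint_left.2 fun x hx hxP => by
      have h1 := hd x hxP hx.2.ne
      have h2 := (le_max_right 0 (p - δ)).trans_lt hx.1
      rw [abs_of_neg (by linarith [hx.2])] at h1
      linarith)
  exact ⟨_, m, c, le_max_left _ _, hlt, hmc⟩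

/-- Every point of `[0, 1)` is the left end of an affine piece. -/
theorem IsPiecewiseLinear.exists_piece_right {f : ℝ → ℝ} (hf : IsPiecewiseLinear f) {p : ℝ}
    (hp : p ∈ Ico (0 : ℝ) 1) : ∃ b m c, b ≤ 1 ∧ IsAffinePiece f p b m c := by
  obtain ⟨P, hP, h⟩ := hf
  obtain ⟨δ, hδ, hd⟩ := hP.exists_pos_le_abs_sub p
  have hlt : p < min 1 (p + δ) := lt_min hp.2 (by linarith)
  obtain ⟨m, c, hmc⟩ := h p ⟨hp.1, hp.2.le⟩ (min 1 (p + δ))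
    ⟨hp.1.trans hlt.le, min_le_left _ _⟩ (disjoint_left.2 fun x hx hxP => by
      have h1 := hd x hxP hx.1.ne'
      have h2 := hx.2.trans_le (min_le_right 1 (p + δ))
      rw [abs_of_pos (by linarith [hx.1])] at h1
      linarith)
  exact ⟨_, m, c, min_le_left _ _, hlt, hmc⟩

theorem IsUniformExpander.finite_turningPoints {lam : ℝ} {f : ℝ → ℝ}
    (hf : IsUniformExpander lam f) : (turningPoints f).Finite := by
  obtain ⟨P, hP, h⟩ := hf.isPiecewiseLinear
  refine hP.subset fun x ⟨hx, hext⟩ => ?_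
  by_contra hxP
  obtain ⟨δ, hδ, hd⟩ := hP.exists_pos_le_abs_sub x
  have ha : max 0 (x - δ) < x := max_lt hx.1 (by linarith)
  have hb : x < min 1 (x + δ) := lt_min hx.2 (by linarith)
  obtain ⟨m, c, hmc⟩ := h (max 0 (x - δ)) ⟨le_max_left _ _, ha.le.trans hx.2.le⟩ (min 1 (x + δ))
    ⟨hx.1.le.trans hb.le, min_le_left _ _⟩ (disjoint_left.2 fun y hy hyP => by
      have h1 := hd y hyP fun h => hxP (h ▸ hyP)
      have h2 := (le_max_right 0 (x - δ)).trans_lt hy.1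
      have h3 := hy.2.trans_le (min_le_right 1 (x + δ))
      exact h1.not_gt (abs_lt.2 ⟨by linarith, by linarith⟩))
  have hpc : IsAffinePiece f (max 0 (x - δ)) (min 1 (x + δ)) m c := ⟨ha.trans hb, hmc⟩
  have h0 := hext.hasDerivAt_eq_zero (hpc.hasDerivAt ⟨ha, hb⟩)
  have h1 := hpc.abs_slope hf (le_max_left _ _) (min_le_left _ _)
  have := hf.one_lt
  rw [h0, abs_zero] at h1
  linarith

/-- The intercepts of the affine pieces of a uniform expander form a finite set, contained in any
field that contains the slope, the turning points, and the value at `0`. -/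
theorem IsUniformExpander.exists_intercepts {lam : ℝ} {f : ℝ → ℝ} (hf : IsUniformExpander lam f)
    {K : IntermediateField ℚ ℝ} (hlam : lam ∈ K) (hturn : turningPoints f ⊆ K) (h0 : f 0 ∈ K) :
    ∃ B : Set ℝ, B.Finite ∧ B ⊆ K ∧
      ∀ a b m c, 0 ≤ a → b ≤ 1 → IsAffinePiece f a b m c → c ∈ B := by
  obtain ⟨P, hP, h⟩ := hf.isPiecewiseLinear
  -- Induction on the number of break points in `(0, t)`, splitting at the last one, `p`.
  have key : ∀ n : ℕ, ∀ t ∈ Ioc (0 : ℝ) 1, (P ∩ Ioo 0 t).ncard = n →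
      ∃ B : Set ℝ, B.Finite ∧ B ⊆ K ∧
        ∀ a b m c, 0 ≤ a → b ≤ t → IsAffinePiece f a b m c → c ∈ B := by
    intro n
    induction n using Nat.strong_induction_on with
    | _ n ih =>
    intro t ht hn
    rcases (P ∩ Ioo 0 t).eq_empty_or_nonempty with he | hne
    · obtain ⟨m, c, hmc⟩ := h 0 ⟨le_rfl, zero_le_one⟩ t ⟨ht.1.le, ht.2⟩
        (disjoint_iff_inter_eq_empty.2 (by rw [inter_comm, he]))
      have hpc : IsAffinePiece f 0 t m c := ⟨ht.1, hmc⟩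
      refine ⟨{c}, finite_singleton c, ?_, fun a b m' c' ha hb hab => ?_⟩
      · rintro _ rfl
        have := hmc 0 ⟨le_rfl, ht.1.le⟩
        rw [mul_zero, zero_add] at this
        exact this ▸ h0
      · exact ((hpc.mono ha hab.lt hb).unique hab).2.symm
    · have hfin : (P ∩ Ioo 0 t).Finite := hP.subset inter_subset_left
      obtain ⟨p, ⟨hpP, hp0, hpt⟩, hpmax⟩ := exists_max_image _ id hfin hne
      obtain ⟨B, hBfin, hBK, hB⟩ := ih (P ∩ Ioo 0 p).ncard (by
        rw [← hn]
        refine ncard_lt_ncard ⟨fun x hx => ⟨hx.1, hx.2.1, hx.2.2.trans hpt⟩, fun hss => ?_⟩ hfin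
        exact lt_irrefl _ (hss ⟨hpP, hp0, hpt⟩).2.2) p ⟨hp0, hpt.le.trans ht.2⟩ rfl
      obtain ⟨m, c, hmc⟩ := h p ⟨hp0.le, hpt.le.trans ht.2⟩ t ⟨ht.1.le, ht.2⟩
        (disjoint_left.2 fun x hx hxP =>
          (hpmax x ⟨hxP, hp0.trans hx.1, hx.2⟩).not_gt hx.1)
      have hpc : IsAffinePiece f p t m c := ⟨hpt, hmc⟩
      refine ⟨insert c B, hBfin.insert c, insert_subset ?_ hBK, fun a b m' c' ha hb hab => ?_⟩
      · obtain ⟨q, m', c', hq, hqc⟩ :=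
          hf.isPiecewiseLinear.exists_piece_left ⟨hp0, hpt.le.trans ht.2⟩
        have hc' : c' ∈ K := hBK (hB q p m' c' hq le_rfl hqc)
        have hm := hpc.abs_slope hf hp0.le ht.2
        have hm' := hqc.abs_slope hf hq (hpt.le.trans ht.2)
        have e1 := hpc.eq p ⟨le_rfl, hpt.le⟩
        have e2 := hqc.eq p ⟨hqc.lt.le, le_rfl⟩
        -- Equal slopes at `p` force equal intercepts by continuity; opposite slopes make `p` a
        -- turning point, hence an element of `K`.
        rcases abs_eq_abs.1 (hm.trans hm'.symm) with hmm | hmm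
        · rw [hmm] at e1
          have : c = c' := by linarith
          exact this ▸ hc'
        · have hpK : p ∈ K := by
            refine hturn ⟨⟨hp0, hpt.trans_le ht.2⟩, ?_⟩
            exact isLocalExtr_of_opposite_slopes hqc (hmm ▸ hpc)
          have hmK : m' ∈ K := by
            rcases eq_or_eq_neg_of_abs_eq hm' with h | h <;> rw [h]
            exacts [hlam, neg_mem hlam]
          have : c = 2 * m' * p + c' := by rw [hmm] at e1; linarith
          rw [this]
          exact add_mem (mul_mem (mul_mem (ofNat_mem K 2) hmK) hpK) hc'
      · rcases lt_or_ge a p with hap | hap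
        · refine Or.inr ?_
          have hlt : a < min b p := lt_min hab.lt hap
          exact hB a (min b p) m' c' ha (min_le_right _ _) (hab.mono le_rfl hlt (min_le_left _ _))
        · exact Or.inl ((hpc.mono hap hab.lt hb).unique hab).2.symm
  exact key _ 1 ⟨zero_lt_one, le_rfl⟩ rfl

theorem IsUniformExpander.isPostcriticallyFinite {lam : ℝ} {f : ℝ → ℝ} (hlam : IsPisot lam)
    (hf : IsUniformExpander lam f) (hturn : turningPoints f ⊆ (ℚ⟮lam⟯ : Set ℝ))
    (h0 : f 0 ∈ ℚ⟮lam⟯) : IsPostcriticallyFinite f := by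
  obtain ⟨B, hBfin, hBK, hB⟩ :=
    hf.exists_intercepts (IntermediateField.mem_adjoin_simple_self ℚ lam) hturn h0
  refine hf.finite_turningPoints.biUnion fun x hx => ?_
  have hmem : ∀ n, f^[n] x ∈ Icc (0 : ℝ) 1 := fun n =>
    hf.isIntervalMap.mapsTo.iterate n ⟨hx.1.1.le, hx.1.2.le⟩
  refine hlam.finite_range_of_signedAffineStep hBfin hBK (hturn hx) (fun n => ?_) (C := 1)
    fun n => abs_le.2 ⟨by linarith [(hmem n).1], (hmem n).2⟩
  rw [Function.iterate_succ_apply']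
  obtain ⟨y0, y1⟩ := hmem n
  generalize f^[n] x = y at y0 y1
  obtain ⟨a, b, m, c, ha, hb, hyab, hpc⟩ :
      ∃ a b m c, 0 ≤ a ∧ b ≤ 1 ∧ y ∈ Icc a b ∧ IsAffinePiece f a b m c := by
    rcases y1.lt_or_eq with hy | rfl
    · obtain ⟨b, m, c, hb, hpc⟩ := hf.isPiecewiseLinear.exists_piece_right ⟨y0, hy⟩
      exact ⟨y, b, m, c, y0, hb, ⟨le_rfl, hpc.lt.le⟩, hpc⟩
    · obtain ⟨a, m, c, ha, hpc⟩ := hf.isPiecewiseLinear.exists_piece_left ⟨zero_lt_one, le_rfl⟩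
      exact ⟨a, 1, m, c, ha, le_rfl, ⟨hpc.lt.le, le_rfl⟩, hpc⟩
  exact ⟨m, c, eq_or_eq_neg_of_abs_eq (hpc.abs_slope hf ha hb), hB a b m c ha hb hpc,
    hpc.eq y hyab⟩

/-! ### Entropy of maps with slopes of constant absolute value -/

/-- On each side of every point, `f` is locally affine with slope `± L`. -/
def HasOneSidedSlopes (L : ℝ) (f : ℝ → ℝ) : Prop :=
  ∀ p, (∃ m c, |m| = L ∧ ∀ᶠ x in 𝓝[≤] p, f x = m * x + c) ∧
    ∃ m c, |m| = L ∧ ∀ᶠ x in 𝓝[≥] p, f x = m * x + c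

/-- An affine germ is monotone, so it sends one side of `p` to one side of `g p`. A composition then
meets a single affine germ of the outer map. -/
theorem tendsto_nhdsLE_or_nhdsGE_of_eventually_affine {m c p : ℝ} {g : ℝ → ℝ}
    (hg : Continuous g) :
    ((∀ᶠ x in 𝓝[≤] p, g x = m * x + c) →
      Tendsto g (𝓝[≤] p) (𝓝[≤] (g p)) ∨ Tendsto g (𝓝[≤] p) (𝓝[≥] (g p))) ∧
    ((∀ᶠ x in 𝓝[≥] p, g x = m * x + c) →
      Tendsto g (𝓝[≥] p) (𝓝[≤] (g p)) ∨ Tendsto g (𝓝[≥] p) (𝓝[≥] (g p))) := by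
  have hc (s : Set ℝ) : Tendsto g (𝓝[s] p) (𝓝 (g p)) := hg.continuousAt.mono_left inf_le_left
  constructor
  · intro h
    have hp : g p = m * p + c := h.self_of_nhdsWithin self_mem_Iic
    rcases le_total 0 m with h0 | h0
    · left
      refine tendsto_nhdsWithin_iff.2 ⟨hc _, ?_⟩
      filter_upwards [h, self_mem_nhdsWithin] with x hx hxp
      rw [mem_Iic] at hxp ⊢
      rw [hx, hp]; nlinarith
    · right
      refine tendsto_nhdsWithin_iff.2 ⟨hc _, ?_⟩
      filter_upwards [h, self_mem_nhdsWithin] with x hx hxp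
      rw [mem_Iic] at hxp
      rw [mem_Ici, hx, hp]; nlinarith
  · intro h
    have hp : g p = m * p + c := h.self_of_nhdsWithin self_mem_Ici
    rcases le_total 0 m with h0 | h0
    · right
      refine tendsto_nhdsWithin_iff.2 ⟨hc _, ?_⟩
      filter_upwards [h, self_mem_nhdsWithin] with x hx hxp
      rw [mem_Ici] at hxp ⊢
      rw [hx, hp]; nlinarith
    · left
      refine tendsto_nhdsWithin_iff.2 ⟨hc _, ?_⟩
      filter_upwards [h, self_mem_nhdsWithin] with x hx hxp
      rw [mem_Ici] at hxp
      rw [mem_Iic, hx, hp]; nlinarith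

theorem HasOneSidedSlopes.comp {L M : ℝ} {f g : ℝ → ℝ} (hf : HasOneSidedSlopes L f)
    (hg : HasOneSidedSlopes M g) (hgc : Continuous g) :
    HasOneSidedSlopes (L * M) (f ∘ g) := by
  have aux {l : Filter ℝ} {p m c : ℝ} (hm : |m| = M) (h : ∀ᶠ x in l, g x = m * x + c)
      (ht : Tendsto g l (𝓝[≤] (g p)) ∨ Tendsto g l (𝓝[≥] (g p))) :
      ∃ m' c', |m'| = L * M ∧ ∀ᶠ x in l, (f ∘ g) x = m' * x + c' := by
    obtain ⟨⟨k, e, hk, he⟩, ⟨k', e', hk', he'⟩⟩ := hf (g p)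
    rcases ht with ht | ht
    · refine ⟨k * m, k * c + e, by rw [abs_mul, hk, hm], ?_⟩
      filter_upwards [h, ht.eventually he] with x hx hx'
      rw [Function.comp_apply, hx', hx]; ring
    · refine ⟨k' * m, k' * c + e', by rw [abs_mul, hk', hm], ?_⟩
      filter_upwards [h, ht.eventually he'] with x hx hx'
      rw [Function.comp_apply, hx', hx]; ring
  intro p
  obtain ⟨⟨m, c, hm, h⟩, ⟨m', c', hm', h'⟩⟩ := hg p
  exact ⟨aux hm h ((tendsto_nhdsLE_or_nhdsGE_of_eventually_affine hgc).1 h),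
    aux hm' h' ((tendsto_nhdsLE_or_nhdsGE_of_eventually_affine hgc).2 h')⟩

theorem HasOneSidedSlopes.iterate {L : ℝ} {f : ℝ → ℝ} (hf : HasOneSidedSlopes L f)
    (hfc : Continuous f) (n : ℕ) : HasOneSidedSlopes (L ^ n) f^[n] := by
  induction n with
  | zero =>
    exact fun p => ⟨⟨1, 0, by simp, by simp⟩, ⟨1, 0, by simp, by simp⟩⟩
  | succ n ih =>
    rw [Function.iterate_succ, pow_succ]
    exact ih.comp hf hfc


theorem Real.volume_preimage_affine {m : ℝ} (hm : m ≠ 0) (c : ℝ) (A : Set ℝ) :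
    volume ((fun x => m * x + c) ⁻¹' A) = ENNReal.ofReal |m⁻¹| * volume A := by
  have : (fun x => m * x + c) ⁻¹' A = (m * ·) ⁻¹' ((· + c) ⁻¹' A) := rfl
  rw [this, Real.volume_preimage_mul_left hm, measure_preimage_add_right]

/-- At a small enough scale, `f` folds at most two-to-one, so that preimages have at most twice
the measure of those of a linear map. -/
theorem HasOneSidedSlopes.exists_volume_le {L : ℝ} {f : ℝ → ℝ} (hf : HasOneSidedSlopes L f)
    (hL : 0 < L) {F : Set ℝ} (hF : IsCompact F) :
    ∃ ε > 0, ∀ x, ∀ A : Set ℝ,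
      volume (F ∩ Metric.ball x ε ∩ f ⁻¹' A) ≤ ENNReal.ofReal (2 / L) * volume A := by
  have loc : ∀ p, ∃ U : Set ℝ, IsOpen U ∧ p ∈ U ∧ ∀ A : Set ℝ,
      volume (U ∩ f ⁻¹' A) ≤ ENNReal.ofReal (2 / L) * volume A := by
    intro p
    obtain ⟨⟨m, c, hm, h⟩, ⟨m', c', hm', h'⟩⟩ := hf p
    obtain ⟨u, hu, hus⟩ := (mem_nhdsLE_iff_exists_Ioc_subset).1 h
    obtain ⟨v, hv, hvs⟩ := (mem_nhdsGE_iff_exists_Ico_subset).1 h'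
    refine ⟨Ioo u v, isOpen_Ioo, ⟨hu, hv⟩, fun A => ?_⟩
    have hsub : Ioo u v ∩ f ⁻¹' A ⊆
        (fun x => m * x + c) ⁻¹' A ∪ (fun x => m' * x + c') ⁻¹' A := by
      rintro x ⟨hx, hxA⟩
      rcases le_total x p with hxp | hxp
      · have e : f x = m * x + c := hus ⟨hx.1, hxp⟩
        exact Or.inl (by rwa [mem_preimage, ← e])
      · have e : f x = m' * x + c' := hvs ⟨hxp, hx.2⟩
        exact Or.inr (by rwa [mem_preimage, ← e])
    have hm0 : m ≠ 0 := fun h => by rw [h, abs_zero] at hm; exact hL.ne hm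
    have hm0' : m' ≠ 0 := fun h => by rw [h, abs_zero] at hm'; exact hL.ne hm'
    -- Each of the two branches contributes a factor `1 / L`.
    refine (measure_mono hsub).trans ((measure_union_le _ _).trans ?_)
    rw [Real.volume_preimage_affine hm0, Real.volume_preimage_affine hm0', abs_inv, abs_inv, hm,
      hm', ← add_mul, ← ENNReal.ofReal_add (by positivity) (by positivity)]
    refine le_of_eq ?_
    congr 2
    ring
  choose U hU hpU hUA using loc
  obtain ⟨δ, hδ, h⟩ := lebesgue_number_lemma_of_metric hF hU
    (fun p _ => mem_iUnion.2 ⟨p, hpU p⟩)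
  -- The centre `x` need not lie in `F`; halving the Lebesgue number allows recentring at a point
  -- `z` of `F`.
  refine ⟨δ / 2, half_pos hδ, fun x A => ?_⟩
  rcases (F ∩ Metric.ball x (δ / 2)).eq_empty_or_nonempty with he | ⟨z, hzF, hzx⟩
  · simp [he]
  · obtain ⟨p, hp⟩ := h z hzF
    refine (measure_mono (inter_subset_inter_left _ ?_)).trans (hUA p A)
    refine inter_subset_right.trans (Subset.trans (fun y hy => ?_) hp)
    rw [Metric.mem_ball] at hzx hy ⊢
    linarith [dist_triangle_right y z x]

/-- A Bowen ball of length `n + 1` at `x` lies in an `ε`-ball intersected with the preimage of one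
of length `n` at `f x`, so each step costs a factor `r`. -/
theorem volume_bowen_ball_le {f : ℝ → ℝ} {F : Set ℝ} (hF : MapsTo f F F) (hF1 : volume F ≤ 1)
    {ε : ℝ} {r : ENNReal}
    (h : ∀ x, ∀ A : Set ℝ, volume (F ∩ Metric.ball x ε ∩ f ⁻¹' A) ≤ r * volume A)
    (n : ℕ) (x : ℝ) :
    volume {y ∈ F | ∀ k < n, dist (f^[k] y) (f^[k] x) < ε} ≤ r ^ n := by
  induction n generalizing x with
  | zero => simpa using hF1
  | succ n ih =>
    refine (measure_mono ?_).trans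
      ((h x {y ∈ F | ∀ k < n, dist (f^[k] y) (f^[k] (f x)) < ε}).trans ?_)
    · rintro y ⟨hy, hyk⟩
      refine ⟨⟨hy, hyk 0 n.succ_pos⟩, hF hy, fun k hk => ?_⟩
      exact hyk (k + 1) (by omega)
    · rw [pow_succ']
      gcongr
      exact ih (f x)


/-- The two-to-one folding loses a factor `2` per step. Applied to `f^[N]`, it loses only `log 2 /
N` of entropy, which vanishes as `N → ∞`. -/
theorem HasOneSidedSlopes.le_coverEntropy {L : ℝ} {f : ℝ → ℝ} (hf : HasOneSidedSlopes L f)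
    (hfc : Continuous f) (hL : 0 < L) (hmaps : MapsTo f (Icc 0 1) (Icc 0 1)) :
    ((Real.log L : ℝ) : EReal) ≤ coverEntropy f (Icc (0 : ℝ) 1) := by
  have key : ∀ N : ℕ, 0 < N →
      ((Real.log L - Real.log 2 / N : ℝ) : EReal) ≤ coverEntropy f (Icc (0 : ℝ) 1) := by
    intro N hN
    have hLN : 0 < L ^ N := pow_pos hL N
    obtain ⟨ε, hε, hvol⟩ := (hf.iterate hfc N).exists_volume_le hLN
      (isCompact_Icc (a := 0) (b := 1))
    refine le_trans ?_
      (coverEntropyEntourage_le_coverEntropy f (Icc 0 1) (Metric.dist_mem_uniformity hε))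
    refine Frequently.le_expGrowthSup ?_
    -- A limsup is bounded below by its values along the multiples of `N`.
    refine frequently_atTop.2 fun n0 => ⟨N * n0, Nat.le_mul_of_pos_left _ hN, ?_⟩
    have hexp : EReal.exp (((Real.log L - Real.log 2 / N : ℝ) : EReal) * ((N * n0 : ℕ) : EReal)) =
        ENNReal.ofReal ((L ^ N / 2) ^ n0) := by
      rw [← EReal.coe_natCast, ← EReal.coe_mul, EReal.exp_coe]
      congr 1
      rw [← Real.exp_log (show 0 < (L ^ N / 2) ^ n0 by positivity), Real.log_pow,
        Real.log_div hLN.ne' two_ne_zero, Real.log_pow]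
      congr 1
      have : (N : ℝ) ≠ 0 := by positivity
      push_cast
      field_simp
    rw [hexp]
    rcases eq_or_ne (coverMincard f (Icc 0 1) {p : ℝ × ℝ | dist p.1 p.2 < ε} (N * n0)) ⊤
      with htop | htop
    · simp [htop]
    obtain ⟨s, hs, hcard⟩ := (coverMincard_finite_iff _ _ _ _).1 (lt_top_iff_ne_top.2 htop)
    rw [← hcard]
    have hsub : Icc (0 : ℝ) 1 ⊆
        ⋃ x ∈ s, {y ∈ Icc (0 : ℝ) 1 | ∀ k < n0, dist ((f^[N])^[k] y) ((f^[N])^[k] x) < ε} := by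
      intro y hy
      obtain ⟨x, hx, hxy⟩ := hs hy
      refine mem_iUnion₂.2 ⟨x, hx, hy, fun k hk => ?_⟩
      rw [← Function.iterate_mul]
      exact mem_dynEntourage.1 hxy (N * k) (Nat.mul_lt_mul_of_pos_left hk hN)
    have hle : (1 : ENNReal) ≤ s.card * ENNReal.ofReal (2 / L ^ N) ^ n0 := by
      calc (1 : ENNReal) = volume (Icc (0 : ℝ) 1) := by simp
        _ ≤ ∑ x ∈ s, volume
            {y ∈ Icc (0 : ℝ) 1 | ∀ k < n0, dist ((f^[N])^[k] y) ((f^[N])^[k] x) < ε} :=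
          (measure_mono hsub).trans (measure_biUnion_finset_le _ _)
        _ ≤ ∑ x ∈ s, ENNReal.ofReal (2 / L ^ N) ^ n0 :=
          Finset.sum_le_sum fun x _ =>
            volume_bowen_ball_le (hmaps.iterate N) (by simp) hvol n0 x
        _ = _ := by simp
    have hle' : (1 : ℝ) ≤ s.card * (2 / L ^ N) ^ n0 := by
      rw [← ENNReal.ofReal_pow (by positivity), ← ENNReal.ofReal_natCast,
        ← ENNReal.ofReal_mul (by positivity), ENNReal.one_le_ofReal] at hle
      exact hle
    rw [show ((s.card : ℕ∞) : ENNReal) = ENNReal.ofReal s.card by simp]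
    refine ENNReal.ofReal_le_ofReal ?_
    calc (L ^ N / 2) ^ n0 ≤ (L ^ N / 2) ^ n0 * (s.card * (2 / L ^ N) ^ n0) :=
          le_mul_of_one_le_right (by positivity) hle'
      _ = s.card * ((L ^ N / 2) * (2 / L ^ N)) ^ n0 := by rw [mul_pow]; ring
      _ = s.card := by
        rw [show L ^ N / 2 * (2 / L ^ N) = 1 by field_simp, one_pow, mul_one]
  have hlim : Tendsto (fun N : ℕ => ((Real.log L - Real.log 2 / ((N + 1 : ℕ) : ℝ) : ℝ) : EReal))
      atTop (𝓝 ((Real.log L : ℝ) : EReal)) := by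
    refine (continuous_coe_real_ereal.tendsto _).comp ?_
    have h0 := (tendsto_const_div_atTop_nhds_zero_nat (Real.log 2)).comp (tendsto_add_atTop_nat 1)
    simpa using tendsto_const_nhds.sub h0
  exact le_of_tendsto' hlim fun N => key (N + 1) N.succ_pos

theorem LipschitzWith.coverEntropy_Icc_le {K : NNReal} {f : ℝ → ℝ} (hf : LipschitzWith K f)
    (hK : 1 ≤ K) : coverEntropy f (Icc (0 : ℝ) 1) ≤ ((Real.log K : ℝ) : EReal) := by
  have hK1 : (1 : ℝ) ≤ K := by exact_mod_cast hK
  have hK0 : (0 : ℝ) < K := by linarith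
  rw [coverEntropy_eq_iSup_basis Metric.uniformity_basis_dist]
  refine iSup₂_le fun ε hε => ?_
  have hlog : ((Real.log K : ℝ) : EReal) = ExpGrowth.expGrowthSup fun n => (K : ENNReal) ^ n := by
    rw [ExpGrowth.expGrowthSup_pow, ENNReal.log_of_nnreal (by positivity)]
  rw [hlog]
  refine ExpGrowth.expGrowthSup_le_of_eventually_le (b := ENNReal.ofReal (1 / ε + 1))
    ENNReal.ofReal_ne_top (Eventually.of_forall fun n => ?_)
  have hKn : (1 : ℝ) ≤ (K : ℝ) ^ n := one_le_pow₀ hK1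
  have hKn0 : (0 : ℝ) < (K : ℝ) ^ n := by linarith
  classical
  let s : Finset ℝ :=
    -- A grid of mesh `ε / K ^ n`: the first `n` iterates stretch distances by at most `K ^ n`.
    (Finset.range (⌊(K : ℝ) ^ n / ε⌋₊ + 1)).image fun i : ℕ => (i : ℝ) * (ε / (K : ℝ) ^ n)
  have hs : IsDynCoverOf f (Icc (0 : ℝ) 1) {p : ℝ × ℝ | dist p.1 p.2 < ε} n s := by
    intro y hy
    have hη : 0 < ε / (K : ℝ) ^ n := by positivity
    have hyη : 0 ≤ y / (ε / (K : ℝ) ^ n) := div_nonneg hy.1 hη.le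
    refine ⟨(⌊y / (ε / (K : ℝ) ^ n)⌋₊ : ℝ) * (ε / (K : ℝ) ^ n), ?_, ?_⟩
    · refine Finset.mem_coe.2 (Finset.mem_image_of_mem _ (Finset.mem_range.2 (Nat.lt_succ_of_le ?_)))
      refine Nat.floor_le_floor ?_
      rw [div_div_eq_mul_div]
      have := hy.2
      gcongr
      nlinarith
    · have h1 := (le_div_iff₀ hη).1 (Nat.floor_le hyη)
      have h2 := (div_lt_iff₀ hη).1 (Nat.lt_floor_add_one (y / (ε / (K : ℝ) ^ n)))
      have hd : dist y ((⌊y / (ε / (K : ℝ) ^ n)⌋₊ : ℝ) * (ε / (K : ℝ) ^ n)) < ε / (K : ℝ) ^ n := by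
        rw [Real.dist_eq, abs_of_nonneg (by linarith)]
        linarith
      refine mem_dynEntourage.2 fun k hk => ?_
      have h3 := (hf.iterate k).dist_le_mul y ((⌊y / (ε / (K : ℝ) ^ n)⌋₊ : ℝ) * (ε / (K : ℝ) ^ n))
      refine h3.trans_lt ?_
      have hkn : (K : ℝ) ^ k ≤ (K : ℝ) ^ n := pow_le_pow_right₀ hK1 hk.le
      push_cast
      calc _ ≤ (K : ℝ) ^ n * _ := mul_le_mul_of_nonneg_right hkn dist_nonneg
        _ < (K : ℝ) ^ n * (ε / (K : ℝ) ^ n) := by gcongr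
        _ = ε := by field_simp
  have hcard : (s.card : ℝ) ≤ (1 / ε + 1) * (K : ℝ) ^ n := by
    have h1 : s.card ≤ ⌊(K : ℝ) ^ n / ε⌋₊ + 1 := by
      simpa using Finset.card_image_le (s := Finset.range (⌊(K : ℝ) ^ n / ε⌋₊ + 1))
        (f := fun i : ℕ => (i : ℝ) * (ε / (K : ℝ) ^ n))
    have h2 : (s.card : ℝ) ≤ (⌊(K : ℝ) ^ n / ε⌋₊ : ℝ) + 1 := by exact_mod_cast h1
    have h3 : (⌊(K : ℝ) ^ n / ε⌋₊ : ℝ) ≤ (K : ℝ) ^ n / ε := Nat.floor_le (by positivity)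
    calc (s.card : ℝ) ≤ (K : ℝ) ^ n / ε + (K : ℝ) ^ n := by linarith
      _ = _ := by ring
  calc ((coverMincard f (Icc (0 : ℝ) 1) {p : ℝ × ℝ | dist p.1 p.2 < ε} n : ℕ∞) : ENNReal)
      ≤ ((s.card : ℕ∞) : ENNReal) := ENat.toENNReal_mono hs.coverMincard_le_card
    _ = ENNReal.ofReal s.card := by simp
    _ ≤ ENNReal.ofReal ((1 / ε + 1) * (K : ℝ) ^ n) := ENNReal.ofReal_le_ofReal hcard
    _ = ENNReal.ofReal (1 / ε + 1) * (K : ENNReal) ^ n := by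
      rw [ENNReal.ofReal_mul (by positivity), ENNReal.ofReal_pow hK0.le, ENNReal.ofReal_coe_nnreal]

/-! ### The triangle wave -/

/-- The triangle wave of slopes `± lam` with zeros `2 * n / d`, for integers `n`. -/
noncomputable def triangleWave (d : ℕ) (lam : ℝ) (x : ℝ) : ℝ :=
  lam * Metric.infDist x (range fun n : ℤ => 2 * (n : ℝ) / d)

namespace triangleWave

variable {d : ℕ} {lam : ℝ}

theorem lipschitzWith (hlam : 0 ≤ lam) : LipschitzWith lam.toNNReal (triangleWave d lam) := by
  refine LipschitzWith.of_dist_le_mul fun x y => ?_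
  have h := (Metric.lipschitz_infDist_pt (range fun n : ℤ => 2 * (n : ℝ) / d)).dist_le_mul x y
  rw [NNReal.coe_one, one_mul, Real.dist_eq] at h
  rw [Real.coe_toNNReal _ hlam, Real.dist_eq, triangleWave, triangleWave, ← mul_sub, abs_mul,
    abs_of_nonneg hlam]
  gcongr

theorem nonneg (hlam : 0 ≤ lam) (x : ℝ) : 0 ≤ triangleWave d lam x :=
  mul_nonneg hlam Metric.infDist_nonneg

/-- Zeros are at least `2 / d` apart, so one within `1 / d` of `x` is a nearest one. -/
theorem eq_mul_abs (hd : 0 < d) {x : ℝ} {n : ℤ} (h : |d * x - 2 * n| ≤ 1) :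
    triangleWave d lam x = lam * |x - 2 * n / d| := by
  have hd' : (0 : ℝ) < d := by exact_mod_cast hd
  rw [triangleWave]
  congr 1
  have hscale (m : ℤ) : |x - 2 * m / d| = |d * x - 2 * m| / d := by
    rw [show x - 2 * m / d = (d * x - 2 * m) / d by field_simp, abs_div, abs_of_pos hd']
  refine le_antisymm ?_ ((Metric.le_infDist (range_nonempty _)).2 ?_)
  · exact (Metric.infDist_le_dist_of_mem (mem_range_self n)).trans_eq (Real.dist_eq _ _)
  · rintro _ ⟨m, rfl⟩
    rw [Real.dist_eq, hscale, hscale]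
    refine div_le_div_of_nonneg_right ?_ hd'.le
    rcases eq_or_ne m n with rfl | hmn
    · exact le_rfl
    · have h1 : (1 : ℝ) ≤ |(m : ℝ) - n| := by
        exact_mod_cast Int.one_le_abs (sub_ne_zero.2 hmn)
      have h2 : |2 * ((m : ℝ) - n)| ≤ |d * x - 2 * n| + |d * x - 2 * m| := by
        rw [show 2 * ((m : ℝ) - n) = (d * x - 2 * n) - (d * x - 2 * m) by ring]
        exact abs_sub _ _
      rw [abs_mul, abs_two] at h2
      linarith

theorem exists_affine (hd : 0 < d) (k : ℤ) (hlam : 0 < lam) :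
    ∃ m c : ℝ, |m| = lam ∧
      ∀ x ∈ Icc ((k : ℝ) / d) ((k + 1 : ℝ) / d), triangleWave d lam x = m * x + c := by
  have hd' : (0 : ℝ) < d := by exact_mod_cast hd
  rcases k.even_or_odd' with ⟨n, rfl | rfl⟩
  · refine ⟨lam, -(lam * (2 * n / d)), abs_of_pos hlam, fun x hx => ?_⟩
    push_cast at hx
    have h1 := (div_le_iff₀ hd').1 hx.1
    have h2 := (le_div_iff₀ hd').1 hx.2
    rw [eq_mul_abs hd (n := n) (abs_le.2 ⟨by linarith, by linarith⟩),
      abs_of_nonneg (sub_nonneg.2 hx.1)]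
    ring
  · refine ⟨-lam, lam * (2 * (n + 1 : ℤ) / d), by rw [abs_neg, abs_of_pos hlam], fun x hx => ?_⟩
    push_cast at hx
    have h1 := (div_le_iff₀ hd').1 hx.1
    have h2 := (le_div_iff₀ hd').1 hx.2
    have h3 : x - 2 * (n + 1 : ℤ) / d ≤ 0 := by
      push_cast
      have := hx.2
      rw [show (2 * (n : ℝ) + 1 + 1) = 2 * (n + 1) by ring] at this
      linarith
    rw [eq_mul_abs hd (n := n + 1)
      (abs_le.2 ⟨by push_cast; linarith, by push_cast; linarith⟩), abs_of_nonpos h3]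
    ring

theorem le_div (hd : 0 < d) (hlam : 0 ≤ lam) (x : ℝ) : triangleWave d lam x ≤ lam / d := by
  have hd' : (0 : ℝ) < d := by exact_mod_cast hd
  have h := abs_sub_round (d * x / 2)
  have h1 : |d * x - 2 * (round (d * x / 2) : ℤ)| ≤ 1 := by
    rw [show d * x - 2 * (round (d * x / 2) : ℤ) = 2 * (d * x / 2 - (round (d * x / 2) : ℤ)) by
      ring, abs_mul, abs_two]
    linarith
  rw [eq_mul_abs hd h1, div_eq_mul_one_div lam]
  refine mul_le_mul_of_nonneg_left ?_ hlam
  rw [show x - 2 * (round (d * x / 2) : ℤ) / d = (d * x - 2 * (round (d * x / 2) : ℤ)) / d by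
    field_simp, abs_div, abs_of_pos hd']
  exact div_le_div_of_nonneg_right h1 hd'.le

theorem hasOneSidedSlopes (hd : 0 < d) (hlam : 0 < lam) :
    HasOneSidedSlopes lam (triangleWave d lam) := by
  have hd' : (0 : ℝ) < d := by exact_mod_cast hd
  intro p
  constructor
  -- Not the floor: when `p` is a node, the cell to its left is needed.
  · obtain ⟨m, c, hm, h⟩ := exists_affine hd (⌈p * d⌉ - 1) hlam
    refine ⟨m, c, hm, ?_⟩
    have h1 : ((⌈p * d⌉ - 1 : ℤ) : ℝ) / d < p := by
      rw [div_lt_iff₀ hd']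
      push_cast
      linarith [Int.ceil_lt_add_one (p * d)]
    filter_upwards [Ioc_mem_nhdsLE h1] with x hx
    refine h x ⟨hx.1.le, hx.2.trans ?_⟩
    rw [le_div_iff₀ hd']
    push_cast
    linarith [Int.le_ceil (p * d)]
  · obtain ⟨m, c, hm, h⟩ := exists_affine hd ⌊p * d⌋ hlam
    refine ⟨m, c, hm, ?_⟩
    have h1 : p < ((⌊p * d⌋ : ℝ) + 1) / d := by
      rw [lt_div_iff₀ hd']
      exact Int.lt_floor_add_one _
    filter_upwards [Ico_mem_nhdsGE h1] with x hx
    refine h x ⟨le_trans ?_ hx.1, hx.2.le⟩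
    rw [div_le_iff₀ hd']
    exact Int.floor_le _

theorem isIntervalMap (hd : 0 < d) (hlam : 0 ≤ lam) (hld : lam ≤ d) :
    IsIntervalMap (triangleWave d lam) where
  continuousOn := (lipschitzWith hlam).continuous.continuousOn
  mapsTo x _ := ⟨nonneg hlam x,
    (le_div hd hlam x).trans (div_le_one_of_le₀ hld (Nat.cast_nonneg d))⟩

theorem isPiecewiseLinear (hd : 0 < d) (hlam : 0 < lam) :
    IsPiecewiseLinear (triangleWave d lam) := by
  have hd' : (0 : ℝ) < d := by exact_mod_cast hd
  refine ⟨(fun k : ℤ => (k : ℝ) / d) '' Icc 0 (d : ℤ), (finite_Icc _ _).image _,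
    fun a ha b hb hab => ?_⟩
  -- An interval without nodes inside cannot leave the cell that contains `a`.
  obtain ⟨m, c, -, h⟩ := exists_affine hd ⌊a * d⌋ hlam
  refine ⟨m, c, fun x hx => h x ⟨?_, hx.2.trans ?_⟩⟩
  · rw [div_le_iff₀ hd']
    exact (Int.floor_le _).trans (by gcongr; exact hx.1)
  · by_contra! hlt
    have h1 : a < ((⌊a * d⌋ : ℝ) + 1) / d := by
      rw [lt_div_iff₀ hd']
      exact Int.lt_floor_add_one _
    refine disjoint_left.1 hab ⟨h1, hlt⟩ ⟨⌊a * d⌋ + 1, ⟨?_, ?_⟩, by push_cast; rfl⟩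
    · have := Int.floor_nonneg.2 (mul_nonneg ha.1 hd'.le)
      omega
    · have h2 := (div_lt_one hd').1 (hlt.trans_le hb.2)
      exact_mod_cast h2.le

theorem isUniformExpander (hd : 0 < d) (hlam : 1 < lam) (hld : lam ≤ d) :
    IsUniformExpander lam (triangleWave d lam) where
  one_lt := hlam
  isIntervalMap := isIntervalMap hd (by linarith) hld
  isPiecewiseLinear := isPiecewiseLinear hd (by linarith)
  abs_deriv x hx m hm := by
    have hlin {k c : ℝ} (s : Set ℝ) (hxs : x ∈ s)
        (he : ∀ᶠ y in 𝓝[s] x, triangleWave d lam y = k * y + c) :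
        HasDerivWithinAt (triangleWave d lam) k s x := by
      have h0 : HasDerivAt (fun x => k * x + c) k x := by
        simpa using ((hasDerivAt_id x).const_mul k).add_const c
      exact h0.hasDerivWithinAt.congr_of_eventuallyEq he (he.self_of_nhdsWithin hxs)
    obtain ⟨⟨k, c, hk, he⟩, ⟨k', c', hk', he'⟩⟩ := hasOneSidedSlopes hd (by linarith : 0 < lam) x
    -- A derivative within `[0, 1]` agrees with the one-sided slope: the right one for `x < 1`, the
    -- left one at `x = 1`.
    rcases hx.2.lt_or_eq with hx1 | hx1
    · have h1 := (hlin (Ici x) self_mem_Ici he').mono (fun y (hy : y ∈ Icc x 1) => hy.1)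
      have h2 := hm.mono (Icc_subset_Icc_left hx.1)
      rw [((uniqueDiffOn_Icc hx1) x ⟨le_rfl, hx1.le⟩).eq_deriv _ h2 h1, hk']
    · have h0 : 0 < x := by linarith
      have h1 := (hlin (Iic x) self_mem_Iic he).mono (fun y (hy : y ∈ Icc 0 x) => hy.2)
      have h2 := hm.mono (Icc_subset_Icc_right hx.2)
      rw [((uniqueDiffOn_Icc h0) x ⟨h0.le, le_rfl⟩).eq_deriv _ h2 h1, hk]

theorem turningPoints_eq (hd : 0 < d) (hlam : 0 < lam) :
    turningPoints (triangleWave d lam) = (fun k : ℤ => (k : ℝ) / d) '' Ioo 0 (d : ℤ) := by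
  have hd' : (0 : ℝ) < d := by exact_mod_cast hd
  ext x
  constructor
  · rintro ⟨hx, hext⟩
    have hk : (⌊x * d⌋ : ℝ) / d = x := by
      by_contra hne
      obtain ⟨m, c, hm, h⟩ := exists_affine hd ⌊x * d⌋ hlam
      have h1 : (⌊x * d⌋ : ℝ) / d < x :=
        lt_of_le_of_ne ((div_le_iff₀ hd').2 (Int.floor_le _)) hne
      have h2 : x < ((⌊x * d⌋ : ℝ) + 1) / d := (lt_div_iff₀ hd').2 (Int.lt_floor_add_one _)
      have hpc : IsAffinePiece (triangleWave d lam) _ _ m c := ⟨h1.trans h2, h⟩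
      have := hext.hasDerivAt_eq_zero (hpc.hasDerivAt ⟨h1, h2⟩)
      rw [this, abs_zero] at hm
      exact hlam.ne hm
    refine ⟨⌊x * d⌋, ⟨?_, ?_⟩, hk⟩
    · have : (0 : ℝ) < ⌊x * d⌋ := by
        have h0 := hx.1
        rw [← hk] at h0
        exact (div_pos_iff_of_pos_right hd').1 h0
      exact_mod_cast this
    · have : (⌊x * d⌋ : ℝ) < d := by
        have h0 := hx.2
        rw [← hk] at h0
        exact (div_lt_one hd').1 h0
      exact_mod_cast this
  · rintro ⟨k, ⟨hk0, hkd⟩, rfl⟩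
    have h0 : (0 : ℝ) < k := by exact_mod_cast hk0
    have h1 : (k : ℝ) < d := by exact_mod_cast hkd
    refine ⟨⟨div_pos h0 hd', (div_lt_one hd').2 h1⟩, ?_⟩
    have hmul : (d : ℝ) * (k / d) = k := by field_simp
    rcases k.even_or_odd' with ⟨n, rfl | rfl⟩
    · left
      refine Eventually.of_forall fun y => ?_
      have : triangleWave d lam (((2 * n : ℤ) : ℝ) / d) = 0 := by
        rw [eq_mul_abs hd (n := n) (by rw [hmul]; simp)]
        simp
      rw [this]
      exact nonneg hlam.le y
    · right
      refine Eventually.of_forall fun y => ?_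
      have : triangleWave d lam (((2 * n + 1 : ℤ) : ℝ) / d) = lam / d := by
        rw [eq_mul_abs hd (n := n) (by rw [hmul]; simp),
          show ((2 * n + 1 : ℤ) : ℝ) / d - 2 * n / d = 1 / d by push_cast; ring,
          abs_of_pos (by positivity), mul_one_div]
      rw [this]
      exact le_div hd hlam.le y

theorem encard_turningPoints (hd : 0 < d) (hlam : 0 < lam) :
    (turningPoints (triangleWave d lam)).encard = ((d - 1 : ℕ) : ℕ∞) := by
  have hd' : (d : ℝ) ≠ 0 := by exact_mod_cast hd.ne'
  have hinj : Function.Injective fun k : ℤ => (k : ℝ) / d := fun a b h => by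
    exact_mod_cast (div_left_inj' hd').1 h
  rw [turningPoints_eq hd hlam, hinj.encard_image, ← Finset.coe_Ioo, encard_coe_eq_coe_finsetCard,
    Int.card_Ioo]
  congr 1
  omega

theorem coverEntropy_eq (hd : 0 < d) (hlam : 1 < lam) (hld : lam ≤ d) :
    coverEntropy (triangleWave d lam) (Icc (0 : ℝ) 1) = ((Real.log lam : ℝ) : EReal) := by
  have h0 : 0 < lam := by linarith
  have hlip := lipschitzWith (d := d) h0.le
  refine le_antisymm ?_ ((hasOneSidedSlopes hd h0).le_coverEntropy hlip.continuous h0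
    (isIntervalMap hd h0.le hld).mapsTo)
  have := hlip.coverEntropy_Icc_le (Real.one_le_toNNReal.2 hlam.le)
  rwa [Real.coe_toNNReal _ h0.le] at this

theorem isPostcriticallyFinite (hd : 0 < d) (hlam : IsPisot lam) (hld : lam ≤ d) :
    IsPostcriticallyFinite (triangleWave d lam) := by
  refine (isUniformExpander hd hlam.1 hld).isPostcriticallyFinite hlam ?_ ?_
  · rw [turningPoints_eq hd (zero_lt_one.trans hlam.1)]
    rintro _ ⟨k, -, rfl⟩
    exact div_mem (intCast_mem _ k) (natCast_mem _ d)
  · have : triangleWave d lam 0 = 0 := by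
      rw [eq_mul_abs hd (n := 0) (by simp)]
      simp
    rw [this]
    exact zero_mem _

end triangleWave

theorem mainTheorem6 :
    (∀ (d : ℕ) (lam : ℝ), 1 < d → IsPisot lam → lam ≤ (d : ℝ) →
      ∃ f : ℝ → ℝ, IsIntervalMap f ∧ IsPostcriticallyFinite f ∧
        (turningPoints f).encard = ((d - 1 : ℕ) : ℕ∞) ∧
        Dynamics.coverEntropy f (Set.Icc (0 : ℝ) 1) = ((Real.log lam : ℝ) : EReal)) ∧
    (∀ (lam : ℝ) (f : ℝ → ℝ), IsPisot lam → IsUniformExpander lam f →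
      turningPoints f ⊆ (ℚ⟮lam⟯ : Set ℝ) → f 0 ∈ ℚ⟮lam⟯ →
      IsPostcriticallyFinite f) := by
  refine ⟨fun d lam hd hlam hld => ?_, fun lam f hlam hf => hf.isPostcriticallyFinite hlam⟩
  have hd0 : 0 < d := by omega
  have h0 : 0 < lam := zero_lt_one.trans hlam.1
  exact ⟨triangleWave d lam, triangleWave.isIntervalMap hd0 h0.le hld,
    triangleWave.isPostcriticallyFinite hd0 hlam hld,
    triangleWave.encard_turningPoints hd0 h0, triangleWave.coverEntropy_eq hd0 hlam.1 hld⟩
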